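/- Let $K\subset\mathbb{R}^n$ be a convex body (a compact convex set with non-empty interior) and let $\Lambda\subset\mathbb{R}^n$ be an $n$-dimensional lattice ($\Lambda=B\mathbb{Z}^n$ with $B\in\mathbb{R}^{n\times n}$ invertible). For $1\le i\le n$ let $$\rho_i(K,\Lambda)=\inf\{\rho>0:\ (\rho\,(K-K)+L)\cap\Lambda\neq L\cap\Lambda\ \text{ for all linear subspaces } L\subseteq\mathbb{R}^n \text{ with } \dim L=n-i\}$$ be the $i$-th packing minimum of $K$ with respect to $\Lambda$. Then every $\rho_i(K,\Lambda)$ is a positive real number, and $$\#(K\cap\Lambda)\ \le\ \prod_{i=1}^n\left\lfloor\frac{1}{\rho_i(K,\Lambda)}+1\right\rfloor .$$ This inequality cannot be improved in general: for all integers $1\le r_1\le r_2\le\dots\le r_n$, equality holds for the box $K=[-r_1,r_1]\times\dots\times[-r_n,r_n]$ and $\Lambda=\mathbb{Z}^n$. -/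

import Mathlib

open scoped Pointwise NNReal

/-- The `i`-th packing minimum of `K ⊆ ℝⁿ` with respect to `Λ`, for `1 ≤ i ≤ n`: the infimum of
all `ρ > 0` such that `(ρ (K - K) + L) ∩ Λ ≠ L ∩ Λ` for every linear subspace `L` of dimension
`n - i`. -/
noncomputable def packingMinimum {n : ℕ} (K : Set (EuclideanSpace ℝ (Fin n)))
    (Λ : Submodule ℤ (EuclideanSpace ℝ (Fin n))) (i : ℕ) : ℝ :=
  sInf {ρ : ℝ | 0 < ρ ∧ ∀ L : Submodule ℝ (EuclideanSpace ℝ (Fin n)),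
    Module.finrank ℝ L = n - i →
      (ρ • (K - K) + (L : Set (EuclideanSpace ℝ (Fin n)))) ∩
          (Λ : Set (EuclideanSpace ℝ (Fin n))) ≠
        (L : Set (EuclideanSpace ℝ (Fin n))) ∩ (Λ : Set (EuclideanSpace ℝ (Fin n)))}

/-- The standard lattice `ℤⁿ` in `ℝⁿ`, spanned by the canonical unit vectors. -/
noncomputable abbrev integerLattice (n : ℕ) : Submodule ℤ (EuclideanSpace ℝ (Fin n)) :=
  Submodule.span ℤ (Set.range (EuclideanSpace.basisFun (Fin n) ℝ).toBasis)

/-- The axis parallel box `C(r) = [-r₁, r₁] × ⋯ × [-rₙ, rₙ]`. -/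
def box {n : ℕ} (r : Fin n → ℝ≥0) : ConvexBody (EuclideanSpace ℝ (Fin n)) where
  carrier := {x | ∀ j, x j ∈ Set.Icc (-(r j : ℝ)) (r j)}
  convex' := by
    intro x hx y hy a b ha hb hab j
    exact convex_Icc (-(r j : ℝ)) (r j : ℝ) (hx j) (hy j) ha hb hab
  isCompact' := by
    have h : IsCompact (Set.univ.pi fun j => Set.Icc (-(r j : ℝ)) (r j : ℝ)) :=
      isCompact_univ_pi fun j => isCompact_Icc
    have h2 := (EuclideanSpace.equiv (Fin n) ℝ).toHomeomorph.isCompact_preimage.2 h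
    convert h2 using 1
    ext x
    rw [Set.mem_preimage, Set.mem_univ_pi]
    rfl
  nonempty' := ⟨0, fun j => by simp⟩

/-- A box with positive side lengths has non-empty interior. -/
theorem interior_box_nonempty {n : ℕ} (r : Fin n → ℝ≥0) (hr : ∀ j, 0 < r j) :
    (interior (box r : Set (EuclideanSpace ℝ (Fin n)))).Nonempty := by
  refine ⟨0, mem_interior.2 ⟨{x | ∀ j, x j ∈ Set.Ioo (-(r j : ℝ)) (r j)}, ?_, ?_, ?_⟩⟩
  · exact fun x hx j => Set.Ioo_subset_Icc_self (hx j)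
  · simp only [Set.ofPred_forall]
    exact isOpen_iInter_of_finite fun j =>
      isOpen_Ioo.preimage (by fun_prop : Continuous fun x : EuclideanSpace ℝ (Fin n) => x j)
  · intro j
    simpa using hr j

/-! For `m ≥ 1` let `F m` be the set of lattice points lying in every subspace that is packing for
`K / m`, and let `F 0 = Λ`. These saturated sublattices decrease with `m`. If `x, y ∈ K ∩ Λ` and `x
- y - m z ∈ F m`, then `z ∈ (K - K) / m + L` for each such subspace `L`, so `z ∈ L`; hence `z ∈ F m`
and `x - y ∈ F m`. So points of `K ∩ Λ` congruent modulo `F (m - 1)` are told apart modulo `F m` by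
their classes in `(ℤ/m)ʳ`, where `r` is the drop in rank (`Submodule.card_image_mkQ_le`).

With `a i = ⌊1 / ρ_i + 1⌋`, the inequality `1 / a i < ρ_i` provides a packing subspace of dimension
`n - i`, so `F (a i)` has rank at most `n - i`. A factor `m` spent in position `i` is therefore at
most `a i`, and `F (a n) = 0` separates all points. -/

/-! ### Counting classes along a chain of saturated subgroups -/

open Module in
/-- The finite quotient `P / (m P + N)` of a free abelian group embeds in `(ℤ/m)ʳ`, where `r` is the
corank of the saturated subgroup `N` in `P`. -/
theorem Submodule.exists_addMonoidHom_zmod {G : Type*} [AddCommGroup G] [Module.Finite ℤ G]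
    {N P : Submodule ℤ G} (hNP : N ≤ P)
    (hN : ∀ (k : ℤ) (z : G), k ≠ 0 → k • z ∈ N → z ∈ N) (m : ℕ) :
    ∃ φ : P →+ (Fin (finrank ℤ P - finrank ℤ N) → ZMod m),
      ∀ p, φ p = 0 → ∃ z : P, (p : G) - m • (z : G) ∈ N := by
  -- Saturation makes `P / N` torsion-free, hence free; `φ` takes its coordinates modulo `m`.
  have htf : IsTorsionFree ℤ (P ⧸ N.submoduleOf P) := by
    refine .of_smul_eq_zero fun k x h => ?_
    obtain ⟨x, rfl⟩ := Submodule.mkQ_surjective _ x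
    rw [← map_smul, Submodule.mkQ_apply, Submodule.Quotient.mk_eq_zero] at h
    rw [or_iff_not_imp_left, Submodule.mkQ_apply, Submodule.Quotient.mk_eq_zero]
    exact fun hk => hN k x hk h
  have hr : finrank ℤ (P ⧸ N.submoduleOf P) = finrank ℤ P - finrank ℤ N := by
    have h := (N.submoduleOf P).finrank_quotient_add_finrank
    rw [(Submodule.submoduleOfEquivOfLe hNP).finrank_eq] at h
    omega
  let b := finBasisOfFinrankEq ℤ (P ⧸ N.submoduleOf P) hr
  let ψ : (P ⧸ N.submoduleOf P) →+ (Fin (finrank ℤ P - finrank ℤ N) → ZMod m) :=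
    ((Int.castAddHom (ZMod m)).compLeft _).comp b.equivFun.toLinearMap.toAddMonoidHom
  refine ⟨ψ.comp (N.submoduleOf P).mkQ.toAddMonoidHom, fun p hp => ?_⟩
  have hdvd : ∀ j, (m : ℤ) ∣ b.equivFun ((N.submoduleOf P).mkQ p) j := fun j =>
    (ZMod.intCast_zmod_eq_zero_iff_dvd _ m).1 (congrFun hp j)
  choose c hc using hdvd
  obtain ⟨z, hz⟩ := Submodule.mkQ_surjective (N.submoduleOf P) (b.equivFun.symm c)
  refine ⟨z, ?_⟩
  have hpz : (N.submoduleOf P).mkQ (p - m • z) = 0 := by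
    rw [map_sub, map_nsmul, hz, sub_eq_zero]
    apply b.equivFun.injective
    rw [map_nsmul, LinearEquiv.apply_symm_apply]
    funext j
    rw [hc j, Pi.smul_apply, nsmul_eq_mul]
  rw [Submodule.mkQ_apply, Submodule.Quotient.mk_eq_zero] at hpz
  exact hpz

open Module in
/-- If elements of `S` that agree modulo `m G + N` differ by an element of `m N + N`, then passing
from `G / P` to `G / N` multiplies the number of classes of `S` by at most `m ^ rank (P / N)`. -/
theorem Submodule.card_image_mkQ_le {G : Type*} [AddCommGroup G] [Module.Finite ℤ G]
    [DecidableEq G] (S : Finset G) {N P : Submodule ℤ G} [DecidableEq (G ⧸ N)]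
    [DecidableEq (G ⧸ P)] (hNP : N ≤ P)
    (hN : ∀ (k : ℤ) (z : G), k ≠ 0 → k • z ∈ N → z ∈ N) {m : ℕ} (hm : m ≠ 0)
    (hsep : ∀ x ∈ S, ∀ y ∈ S, ∀ z, x - y - m • z ∈ N → z ∈ N) :
    (S.image N.mkQ).card ≤ (S.image P.mkQ).card * m ^ (finrank ℤ P - finrank ℤ N) := by
  have : NeZero m := ⟨hm⟩
  obtain ⟨φ, hφ⟩ := Submodule.exists_addMonoidHom_zmod hNP hN m
  have himage : (S.image N.mkQ).image (Submodule.factor hNP) = S.image P.mkQ := by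
    rw [Finset.image_image]
    rfl
  rw [← himage, mul_comm]
  refine Finset.card_le_mul_card_image _ _ fun q hq => ?_
  rw [himage] at hq
  obtain ⟨x₀, hx₀, rfl⟩ := Finset.mem_image.1 hq
  have hrep : ∀ t : G ⧸ N, ∃ x : G, t ∈ S.image N.mkQ → x ∈ S ∧ N.mkQ x = t := by
    intro t
    by_cases ht : t ∈ S.image N.mkQ
    · obtain ⟨x, hx⟩ := Finset.mem_image.1 ht
      exact ⟨x, fun _ => hx⟩
    · exact ⟨0, fun h => absurd h ht⟩
  choose rep hrep using hrep
  have hdiff : ∀ t ∈ S.image N.mkQ, Submodule.factor hNP t = P.mkQ x₀ → rep t - x₀ ∈ P := by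
    intro t ht h
    rw [← (Submodule.Quotient.eq P), ← Submodule.mkQ_apply, ← Submodule.mkQ_apply, ← h]
    conv_rhs => rw [← (hrep t ht).2]
    rfl
  classical
  -- The fibre lies over a single class modulo `P`, so subtracting `x₀` lands in `P`; the default
  -- `0` is never used on it.
  let g : G ⧸ N → (Fin (finrank ℤ P - finrank ℤ N) → ZMod m) := fun t =>
    if h : rep t - x₀ ∈ P then φ ⟨rep t - x₀, h⟩ else 0
  calc _ ≤ (Finset.univ : Finset (Fin (finrank ℤ P - finrank ℤ N) → ZMod m)).card := by
        refine Finset.card_le_card_of_injOn g (fun _ _ => Finset.mem_coe.2 (Finset.mem_univ _)) ?_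
        intro t ht u hu htu
        obtain ⟨ht, ht'⟩ := Finset.mem_filter.1 ht
        obtain ⟨hu, hu'⟩ := Finset.mem_filter.1 hu
        have h1 := hdiff t ht ht'
        have h2 := hdiff u hu hu'
        simp only [g, dif_pos h1, dif_pos h2] at htu
        rw [← sub_eq_zero, ← map_sub] at htu
        obtain ⟨z, hz⟩ := hφ _ htu
        have hz' : rep t - rep u - m • (z : G) ∈ N := by
          simpa using hz
        have hzN := hsep _ (hrep t ht).1 _ (hrep u hu).1 _ hz'
        have : rep t - rep u ∈ N := by
          simpa using N.add_mem hz' (N.smul_of_tower_mem m hzN)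
        rw [← (hrep t ht).2, ← (hrep u hu).2]
        exact (Submodule.Quotient.eq N).2 this
    _ = m ^ (finrank ℤ P - finrank ℤ N) := by simp [ZMod.card]

open Module in
/-- Counting along a descending chain `F 0 = G ⊇ F 1 ⊇ ⋯` of saturated subgroups, the `m`-th of
which separates `S` modulo `m`. -/
theorem Submodule.card_image_mkQ_le_prod {G : Type*} [AddCommGroup G] [Module.Finite ℤ G]
    [DecidableEq G] (S : Finset G) {F : ℕ → Submodule ℤ G} [∀ m, DecidableEq (G ⧸ F m)]
    (hF : Antitone F) (hF0 : F 0 = ⊤)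
    (hsat : ∀ m, ∀ (k : ℤ) (z : G), k ≠ 0 → k • z ∈ F m → z ∈ F m)
    (hsep : ∀ m ≠ 0, ∀ x ∈ S, ∀ y ∈ S, ∀ z, x - y - m • z ∈ F m → z ∈ F m)
    {n : ℕ} (hn : finrank ℤ G = n) {a : ℕ → ℕ}
    (ha : ∀ i ∈ Finset.Icc 1 n, finrank ℤ (F (a i)) ≤ n - i) (m : ℕ) :
    (S.image (F m).mkQ).card ≤ ∏ i ∈ Finset.Ioc 0 (n - finrank ℤ (F m)), a i := by
  have hmono : ∀ k l, k ≤ l → finrank ℤ (F l) ≤ finrank ℤ (F k) := fun k l h =>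
    Submodule.finrank_mono (hF h)
  have hle : ∀ k, finrank ℤ (F k) ≤ n := fun k => hn ▸ Submodule.finrank_le _
  induction m with
  | zero =>
    have h0 : n - finrank ℤ (F 0) = 0 := by rw [hF0, finrank_top, hn, Nat.sub_self]
    rw [h0, Finset.Ioc_self, Finset.prod_empty]
    refine Finset.card_le_one.2 fun x _ y _ => ?_
    have : Subsingleton (G ⧸ F 0) := Submodule.Quotient.subsingleton_iff.2 hF0
    exact Subsingleton.elim _ _
  | succ m ih =>
    have h1 := hmono m (m + 1) m.le_succ
    have h2 := hle m
    rw [← Finset.prod_Ioc_consecutive a (Nat.zero_le (n - finrank ℤ (F m)))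
      (Nat.sub_le_sub_left h1 n)]
    refine (Submodule.card_image_mkQ_le S (hF m.le_succ) (hsat _) m.succ_ne_zero
      (hsep _ m.succ_ne_zero)).trans (Nat.mul_le_mul ih ?_)
    calc (m + 1) ^ (finrank ℤ (F m) - finrank ℤ (F (m + 1)))
        = (m + 1) ^ (Finset.Ioc (n - finrank ℤ (F m)) (n - finrank ℤ (F (m + 1)))).card := by
          rw [Nat.card_Ioc]
          congr 1
          omega
      _ ≤ _ := by
          refine Finset.pow_card_le_prod _ _ _ fun i hi => ?_
          rw [Finset.mem_Ioc] at hi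
          -- If `a i ≤ m`, then `F m ≤ F (a i)` has rank at most `n - i`, contrary to `i > n - rank
          -- (F m)`.
          by_contra! hlt
          have h3 := hmono (a i) m (by omega)
          have h4 := ha i (Finset.mem_Icc.2 ⟨by omega, by omega⟩)
          omega

/-! ### Packing subspaces and bounds for the packing minima -/

/-- `L` absorbs all lattice points of the cylinder `ρ (K - K) + L`: the translates of `ρ K + L` by
the lattice form a packing. -/
def IsPackingSubspace {n : ℕ} (K : Set (EuclideanSpace ℝ (Fin n)))
    (Λ : Submodule ℤ (EuclideanSpace ℝ (Fin n))) (ρ : ℝ)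
    (L : Submodule ℝ (EuclideanSpace ℝ (Fin n))) : Prop :=
  ∀ x ∈ Λ, x ∈ ρ • (K - K) + (L : Set (EuclideanSpace ℝ (Fin n))) → x ∈ L

section PackingSubspace

variable {n : ℕ} {K : Set (EuclideanSpace ℝ (Fin n))}
  {Λ : Submodule ℤ (EuclideanSpace ℝ (Fin n))}

/-- The dilates of `K - K` are nested, since it is convex and contains `0`. -/
theorem IsPackingSubspace.anti (hK : Convex ℝ K) (hne : K.Nonempty) {ρ σ : ℝ} (hρ : 0 ≤ ρ)
    (hρσ : ρ ≤ σ) {L : Submodule ℝ (EuclideanSpace ℝ (Fin n))}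
    (h : IsPackingSubspace K Λ σ L) : IsPackingSubspace K Λ ρ L := by
  intro x hx hxL
  refine h x hx (Set.add_subset_add_right ?_ hxL)
  have h0 : (0 : EuclideanSpace ℝ (Fin n)) ∈ K - K := by
    obtain ⟨k, hk⟩ := hne
    exact ⟨k, hk, k, hk, sub_self k⟩
  rintro _ ⟨k, hk, rfl⟩
  rcases (hρ.trans hρσ).eq_or_lt with h | hσ
  · have : ρ = σ := by linarith
    exact this ▸ Set.smul_mem_smul_set hk
  · refine ⟨(ρ / σ) • k, (hK.sub hK).smul_mem_of_zero_mem h0 hk ⟨by positivity, ?_⟩, ?_⟩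
    · exact (div_le_one hσ).2 hρσ
    · simp only [smul_smul]
      rw [mul_div_cancel₀ _ hσ.ne']

theorem exists_isPackingSubspace_of_lt_packingMinimum {i : ℕ} {ρ : ℝ} (hρ : 0 < ρ)
    (h : ρ < packingMinimum K Λ i) :
    ∃ L : Submodule ℝ (EuclideanSpace ℝ (Fin n)), Module.finrank ℝ L = n - i ∧
      IsPackingSubspace K Λ ρ L := by
  have hnot := notMem_of_lt_csInf h ⟨0, fun _ hx => hx.1.le⟩
  simp only [Set.mem_ofPred_eq, not_and, not_forall, not_not] at hnot
  obtain ⟨L, hL, heq⟩ := hnot hρ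
  refine ⟨L, hL, fun x hx hxL => ?_⟩
  have : x ∈ (L : Set (EuclideanSpace ℝ (Fin n))) ∩ Λ := heq ▸ ⟨hxL, hx⟩
  exact this.1

/-- `hfar` makes the set of admissible `ρ` non-empty; otherwise its `sInf` would be the default
value `0`. -/
theorem le_packingMinimum (hne : K.Nonempty) {i : ℕ} {ε : ℝ}
    (hfar : ∃ ρ : ℝ, 0 < ρ ∧ ∀ L : Submodule ℝ (EuclideanSpace ℝ (Fin n)),
      Module.finrank ℝ L = n - i → ¬ IsPackingSubspace K Λ ρ L)
    (hnear : ∀ ρ : ℝ, 0 < ρ → ρ < ε → ∃ L : Submodule ℝ (EuclideanSpace ℝ (Fin n)),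
      Module.finrank ℝ L = n - i ∧ IsPackingSubspace K Λ ρ L) :
    ε ≤ packingMinimum K Λ i := by
  obtain ⟨ρ, hρ, hρL⟩ := hfar
  refine le_csInf ⟨ρ, hρ, fun L hL heq => hρL L hL fun x hx hxL => ?_⟩ ?_
  · have : x ∈ (L : Set (EuclideanSpace ℝ (Fin n))) ∩ Λ := heq ▸ ⟨hxL, hx⟩
    exact this.1
  · rintro σ ⟨hσ, hσL⟩
    by_contra! hlt
    obtain ⟨L, hL, hpack⟩ := hnear σ hσ hlt
    refine hσL L hL (Set.Subset.antisymm (fun x hx => ⟨hpack x hx.2 hx.1, hx.2⟩)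
      fun x hx => ⟨?_, hx.2⟩)
    obtain ⟨k, hk⟩ := hne
    exact ⟨0, ⟨0, ⟨k, hk, k, hk, sub_self k⟩, smul_zero σ⟩, x, hx.1, zero_add x⟩

/-- If some `i` coordinates with respect to a lattice basis are bounded by `R` on `K - K`, then the
`i`-th packing minimum is at least `1 / R`. -/
theorem le_packingMinimum_of_basis {ι : Type*} [Fintype ι]
    (b : Module.Basis ι ℝ (EuclideanSpace ℝ (Fin n))) (hK : (interior K).Nonempty) {i : ℕ}
    (hi : i ∈ Finset.Icc 1 n) {s : Finset ι} (hs : s.card = i) {R : ℝ} (hR : 0 < R)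
    (hbound : ∀ k ∈ K - K, ∀ j ∈ s, |b.repr k j| ≤ R) :
    1 / R ≤ packingMinimum K (Submodule.span ℤ (Set.range b)) i := by
  classical
  have hcard : Fintype.card ι = n := by
    rw [← Module.finrank_eq_card_basis b, finrank_euclideanSpace_fin]
  rw [Finset.mem_Icc] at hi
  refine le_packingMinimum (hK.mono interior_subset) ?_ fun ρ hρ hρR => ?_
  · have h0 : K - K ∈ nhds (0 : EuclideanSpace ℝ (Fin n)) := by
      obtain ⟨k, hk⟩ := hK
      have hopen : IsOpen (interior K - K) := isOpen_interior.sub_right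
      exact Filter.mem_of_superset
        (hopen.mem_nhds ⟨k, hk, k, interior_subset hk, sub_self k⟩)
        (Set.sub_subset_sub_right interior_subset)
    obtain ⟨r, hr, hball⟩ := Metric.mem_nhds_iff.1 h0
    have hsum : 0 ≤ ∑ j, ‖b j‖ := Finset.sum_nonneg fun _ _ => norm_nonneg _
    -- At this scale the dilate of `K - K` contains every `b j`, so a packing subspace is the whole
    -- space, impossible as `i ≥ 1`.
    have hρ : 0 < (∑ j, ‖b j‖ + 1) / r := by positivity
    refine ⟨(∑ j, ‖b j‖ + 1) / r, hρ, fun L hL hpack => ?_⟩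
    have htop : L = ⊤ := by
      rw [eq_top_iff, ← b.span_eq, Submodule.span_le]
      rintro _ ⟨j, rfl⟩
      refine hpack _ (Submodule.subset_span ⟨j, rfl⟩) ⟨b j, ?_, 0, L.zero_mem, add_zero _⟩
      rw [Set.mem_smul_set_iff_inv_smul_mem₀ hρ.ne']
      apply hball
      rw [mem_ball_zero_iff, norm_smul, norm_inv, Real.norm_of_nonneg hρ.le, inv_div,
        div_mul_eq_mul_div, div_lt_iff₀ (by positivity)]
      have := Finset.single_le_sum (f := fun j => ‖b j‖) (fun j _ => norm_nonneg (b j))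
        (Finset.mem_univ j)
      exact mul_lt_mul_of_pos_left (by linarith) hr
    rw [htop, finrank_top, finrank_euclideanSpace_fin] at hL
    omega
  -- Modulo the span of the other basis vectors only the coordinates in `s` remain; for a lattice
  -- point they are integers of absolute value at most `ρ R < 1`.
  · refine ⟨Submodule.span ℝ (b '' (s : Set ι)ᶜ), ?_, fun x hx hxL => ?_⟩
    · have hli : LinearIndependent ℝ fun j : ((s : Set ι)ᶜ : Set ι) => b j :=
        b.linearIndependent.comp _ Subtype.val_injective
      rw [Set.image_eq_range, finrank_span_eq_card hli, Fintype.card_compl_set]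
      simp [hcard, hs]
    · rw [b.mem_span_image]
      intro j hj hjs
      obtain ⟨_, ⟨k, hk, rfl⟩, l, hl, rfl⟩ := hxL
      obtain ⟨c, hc⟩ := b.mem_span_iff_repr_mem ℤ _ |>.1 hx j
      have hlj : b.repr l j = 0 := by
        by_contra hne
        exact (b.mem_span_image.1 hl) (Finsupp.mem_support_iff.2 hne) hjs
      have hkj := hbound k hk j hjs
      have hcoord : b.repr (ρ • k + l) j = ρ * b.repr k j := by simp [hlj]
      have hlt : |(c : ℝ)| < 1 := by
        have : (c : ℝ) = ρ * b.repr k j := by rw [← hcoord, ← hc]; simp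
        rw [this, abs_mul, abs_of_pos hρ]
        calc ρ * |b.repr k j| ≤ ρ * R := by gcongr
          _ < 1 := (lt_div_iff₀ hR).1 hρR
      have hc0 : c = 0 := Int.abs_lt_one_iff.1 (by exact_mod_cast hlt)
      refine Finsupp.mem_support_iff.1 hj ?_
      change b.repr (ρ • k + l) j = 0
      rw [← hc, hc0]
      simp

/-- Coordinates in a lattice basis are bounded on the compact set `K - K`. -/
theorem packingMinimum_pos [DiscreteTopology Λ] [IsZLattice ℝ Λ] (hcpt : IsCompact K)
    (hK : (interior K).Nonempty) {i : ℕ} (hi : i ∈ Finset.Icc 1 n) :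
    0 < packingMinimum K Λ i := by
  have : Module.Finite ℤ Λ := ZLattice.module_finite ℝ Λ
  have : Module.Free ℤ Λ := ZLattice.module_free ℝ Λ
  let b := (Module.finBasis ℤ Λ).ofZLatticeBasis ℝ Λ
  have hcard : Module.finrank ℤ Λ = n := by
    rw [ZLattice.rank ℝ Λ, finrank_euclideanSpace_fin]
  obtain ⟨s, -, hs⟩ := Finset.exists_subset_card_eq
    (s := (Finset.univ : Finset (Fin (Module.finrank ℤ Λ)))) (n := i)
    (by simpa [hcard] using (Finset.mem_Icc.1 hi).2)
  obtain ⟨C, hC⟩ := (sub_eq_add_neg K K ▸ hcpt.add hcpt.neg : IsCompact (K - K)).exists_bound_of_continuousOn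
    (f := fun x => b.equivFun x) (continuous_equivFun_basis b).continuousOn
  have hpos : 0 < |C| + 1 := by positivity
  have h := le_packingMinimum_of_basis b hK hi hs hpos fun k hk j _ => by
    have h1 := norm_le_pi_norm (b.equivFun k) j
    rw [Module.Basis.equivFun_apply, Real.norm_eq_abs] at h1
    have h2 := hC k hk
    rw [Module.Basis.equivFun_apply] at h2
    linarith [le_abs_self C]
  rw [Module.Basis.ofZLatticeBasis_span] at h
  exact (by positivity : 0 < 1 / (|C| + 1)).trans_le h

/-! ### The chain of sublattices and the upper bound -/

/-- The lattice points common to all subspaces that are packing for `K / m`; the whole lattice when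
`m = 0`. -/
def packingSublattice (K : Set (EuclideanSpace ℝ (Fin n)))
    (Λ : Submodule ℤ (EuclideanSpace ℝ (Fin n))) (m : ℕ) : Submodule ℤ Λ :=
  ((sInf {L | m ≠ 0 ∧ IsPackingSubspace K Λ (1 / m) L}).restrictScalars ℤ).comap Λ.subtype

theorem mem_packingSublattice {m : ℕ} {z : Λ} :
    z ∈ packingSublattice K Λ m ↔
      ∀ L, m ≠ 0 → IsPackingSubspace K Λ (1 / m) L → (z : EuclideanSpace ℝ (Fin n)) ∈ L := by
  rw [packingSublattice, Submodule.mem_comap, Submodule.restrictScalars_mem, Submodule.mem_sInf]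
  simp only [Set.mem_ofPred_eq, and_imp, Submodule.subtype_apply]

theorem packingSublattice_zero : packingSublattice K Λ 0 = ⊤ :=
  eq_top_iff.2 fun _ _ => mem_packingSublattice.2 fun _ h => absurd rfl h

theorem antitone_packingSublattice (hK : Convex ℝ K) (hne : K.Nonempty) :
    Antitone (packingSublattice K Λ) := by
  intro k m hkm z hz
  rw [mem_packingSublattice] at hz ⊢
  intro L hk hL
  have hk' : 0 < k := Nat.pos_of_ne_zero hk
  refine hz L (by omega) (hL.anti hK hne (by positivity) ?_)
  exact one_div_le_one_div_of_le (by exact_mod_cast hk') (by exact_mod_cast hkm)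

theorem mem_packingSublattice_of_smul_mem {m : ℕ} {k : ℤ} {z : Λ} (hk : k ≠ 0)
    (h : k • z ∈ packingSublattice K Λ m) : z ∈ packingSublattice K Λ m := by
  rw [mem_packingSublattice] at h ⊢
  intro L hm hL
  have h1 := h L hm hL
  rw [Submodule.coe_smul, ← Int.cast_smul_eq_zsmul ℝ] at h1
  exact (L.smul_mem_iff (Int.cast_ne_zero.2 hk)).1 h1

theorem mem_packingSublattice_of_sub_smul_mem {m : ℕ} (hm : m ≠ 0) {x y z : Λ} (hx : (x : EuclideanSpace ℝ (Fin n)) ∈ K)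
    (hy : (y : EuclideanSpace ℝ (Fin n)) ∈ K) (h : x - y - m • z ∈ packingSublattice K Λ m) :
    z ∈ packingSublattice K Λ m := by
  rw [mem_packingSublattice] at h ⊢
  intro L _ hL
  have hm' : (m : ℝ) ≠ 0 := Nat.cast_ne_zero.2 hm
  refine hL z z.2 ⟨_, Set.smul_mem_smul_set (Set.sub_mem_sub hx hy), _,
    L.smul_mem (-(1 / m : ℝ)) (h L hm hL), ?_⟩
  have hz : (1 / m : ℝ) • ((m • z : Λ) : EuclideanSpace ℝ (Fin n)) = z := by
    rw [Submodule.coe_smul_of_tower, ← Nat.cast_smul_eq_nsmul ℝ, smul_smul,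
      one_div_mul_cancel hm', one_smul]
  simp only [Submodule.coe_sub, neg_smul, smul_sub, hz]
  abel

/-- A discrete subgroup has the same rank as its real span, and that span lies in `L`. -/
theorem finrank_packingSublattice_le [DiscreteTopology Λ] {m : ℕ} (hm : m ≠ 0)
    {L : Submodule ℝ (EuclideanSpace ℝ (Fin n))} (hL : IsPackingSubspace K Λ (1 / m) L) :
    Module.finrank ℤ (packingSublattice K Λ m) ≤ Module.finrank ℝ L := by
  set M := (packingSublattice K Λ m).map Λ.subtype with hM
  have hdisc : DiscreteTopology (Submodule.span ℤ (M : Set (EuclideanSpace ℝ (Fin n)))) := by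
    rw [Submodule.span_eq, ← SetLike.isDiscrete_iff_discreteTopology]
    exact (inferInstance : DiscreteTopology Λ).isDiscrete.mono (Submodule.map_subtype_le _ _)
  have h := Real.finrank_eq_int_finrank_of_discrete hdisc
  rw [Set.finrank, Set.finrank, Submodule.span_eq, hM, Submodule.finrank_map_subtype_eq] at h
  rw [← h]
  refine Submodule.finrank_mono (Submodule.span_le.2 ?_)
  rintro _ ⟨z, hz, rfl⟩
  exact mem_packingSublattice.1 hz L hm hL

theorem encard_inter_le_prod_packingMinimum [DiscreteTopology Λ] [IsZLattice ℝ Λ]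
    (hconv : Convex ℝ K) (hcpt : IsCompact K) (hK : (interior K).Nonempty) :
    (K ∩ (Λ : Set (EuclideanSpace ℝ (Fin n)))).encard ≤
      ((∏ i ∈ Finset.Icc 1 n, ⌊1 / packingMinimum K Λ i + 1⌋₊ : ℕ) : ℕ∞) := by
  classical
  have hfin : Module.Finite ℤ Λ := ZLattice.module_finite ℝ Λ
  have hfree : Module.Free ℤ Λ := ZLattice.module_free ℝ Λ
  have hrank : Module.finrank ℤ Λ = n := by
    rw [ZLattice.rank ℝ Λ, finrank_euclideanSpace_fin]
  have hanti : Antitone (packingSublattice K Λ) :=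
    antitone_packingSublattice hconv (hK.mono interior_subset)
  have hfinite : (K ∩ (Λ : Set (EuclideanSpace ℝ (Fin n)))).Finite := by
    have : DiscreteTopology Λ.toAddSubgroup := (inferInstance : DiscreteTopology Λ)
    exact Metric.finite_isBounded_inter_isClosed DiscreteTopology.isDiscrete hcpt.isBounded
      (AddSubgroup.isClosed_of_discrete (H := Λ.toAddSubgroup))
  have hfinite' : {z : Λ | (z : EuclideanSpace ℝ (Fin n)) ∈ K}.Finite := by
    refine Set.Finite.of_finite_image (f := ((↑) : Λ → EuclideanSpace ℝ (Fin n)))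
      (hfinite.subset ?_) Subtype.val_injective.injOn
    rintro _ ⟨z, hz, rfl⟩
    exact ⟨hz, z.2⟩
  set S := hfinite'.toFinset with hS
  have hmemS : ∀ z : Λ, z ∈ S ↔ (z : EuclideanSpace ℝ (Fin n)) ∈ K := by simp [hS]
  set a : ℕ → ℕ := fun i => ⌊1 / packingMinimum K Λ i + 1⌋₊ with ha
  have ha0 : ∀ i ∈ Finset.Icc 1 n, a i ≠ 0 ∧ 1 / (a i : ℝ) < packingMinimum K Λ i := by
    intro i hi
    have hpos := packingMinimum_pos (Λ := Λ) hcpt hK hi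
    -- The `+ 1` makes `1 / ρ_i < a i` strict, as needed to get below the infimum.
    have hai : a i = ⌊1 / packingMinimum K Λ i⌋₊ + 1 := Nat.floor_add_one (by positivity)
    have hne : a i ≠ 0 := by omega
    refine ⟨hne, ?_⟩
    rw [one_div_lt (by positivity) hpos, hai]
    exact_mod_cast Nat.lt_floor_add_one _
  have harank : ∀ i ∈ Finset.Icc 1 n,
      Module.finrank ℤ (packingSublattice K Λ (a i)) ≤ n - i := by
    intro i hi
    obtain ⟨hne, hlt⟩ := ha0 i hi
    obtain ⟨L, hL, hpack⟩ :=
      exists_isPackingSubspace_of_lt_packingMinimum (by positivity) hlt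
    exact hL ▸ finrank_packingSublattice_le hne hpack
  have hzero : Module.finrank ℤ (packingSublattice K Λ (a n)) = 0 := by
    -- For `n = 0` the index `n` lies outside `Icc 1 n`, but the lattice itself has rank `0`.
    rcases Nat.eq_zero_or_pos n with h | h
    · exact Nat.eq_zero_of_le_zero ((Submodule.finrank_le _).trans (hrank.trans h).le)
    · simpa using harank n (Finset.mem_Icc.2 ⟨h, le_rfl⟩)
  have hbot : packingSublattice K Λ (a n) = ⊥ := Submodule.finrank_eq_zero.1 hzero
  have hcount := Submodule.card_image_mkQ_le_prod S hanti packingSublattice_zero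
    (fun m k z => mem_packingSublattice_of_smul_mem)
    (fun m hm x hx y hy z => mem_packingSublattice_of_sub_smul_mem hm ((hmemS x).1 hx)
      ((hmemS y).1 hy)) hrank harank (a n)
  rw [hzero, Nat.sub_zero, Finset.card_image_of_injective] at hcount
  · have himage : K ∩ (Λ : Set (EuclideanSpace ℝ (Fin n))) =
        ((↑) : Λ → EuclideanSpace ℝ (Fin n)) '' (S : Set Λ) := by
      ext x
      constructor
      · rintro ⟨hx, hxΛ⟩
        exact ⟨⟨x, hxΛ⟩, (hmemS _).2 hx, rfl⟩
      · rintro ⟨z, hz, rfl⟩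
        exact ⟨(hmemS z).1 hz, z.2⟩
    rw [himage, Subtype.val_injective.encard_image, Set.encard_coe_eq_coe_finsetCard]
    exact_mod_cast hcount
  · rw [← LinearMap.ker_eq_bot, Submodule.ker_mkQ, hbot]

end PackingSubspace

/-! ### Equality for boxes -/

theorem inv_le_packingMinimum_box {n : ℕ} {r : Fin n → ℕ} (hr : ∀ j, 0 < r j) (hmono : Monotone r)
    (j : Fin n) :
    1 / (2 * r j : ℝ) ≤ packingMinimum
      (box (fun j => (r j : ℝ≥0)) : Set (EuclideanSpace ℝ (Fin n))) (integerLattice n) (j + 1) := by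
  have hrj : (0 : ℝ) < r j := Nat.cast_pos.2 (hr j)
  refine le_packingMinimum_of_basis _
    (interior_box_nonempty _ fun j => by exact_mod_cast hr j)
    -- The `j + 1` coordinates up to `j` are the shortest sides; differences there are at most `2 r
    -- j`.
    (Finset.mem_Icc.2 ⟨by omega, j.2⟩) (s := Finset.Iic j) (by simp) (by positivity) ?_
  rintro _ ⟨x, hx, y, hy, rfl⟩ l hl
  have h1 := hx l
  have h2 := hy l
  have h3 : (r l : ℝ) ≤ r j := Nat.cast_le.2 (hmono (Finset.mem_Iic.1 hl))
  simp only [Set.mem_Icc, NNReal.coe_natCast] at h1 h2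
  simp only [OrthonormalBasis.coe_toBasis_repr_apply, EuclideanSpace.basisFun_repr,
    PiLp.sub_apply]
  rw [abs_le]
  constructor <;> linarith

theorem prod_le_encard_box_inter_integerLattice {n : ℕ} (r : Fin n → ℕ) :
    ((∏ j, (2 * r j + 1) : ℕ) : ℕ∞) ≤
      ((box (fun j => (r j : ℝ≥0)) : Set (EuclideanSpace ℝ (Fin n))) ∩
        (integerLattice n : Set (EuclideanSpace ℝ (Fin n)))).encard := by
  let T : Finset (Fin n → ℤ) := Fintype.piFinset fun j => Finset.Icc (-(r j : ℤ)) (r j)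
  let f : (Fin n → ℤ) → EuclideanSpace ℝ (Fin n) := fun z => WithLp.toLp 2 fun j => (z j : ℝ)
  have hf : Function.Injective f := by
    intro z w h
    funext j
    have : (z j : ℝ) = w j := congrArg (fun x : EuclideanSpace ℝ (Fin n) => x j) h
    exact_mod_cast this
  have hT : T.card = ∏ j, (2 * r j + 1) := by
    rw [Fintype.card_piFinset]
    refine Finset.prod_congr rfl fun j _ => ?_
    rw [Int.card_Icc]
    omega
  rw [← hT, ← Set.encard_coe_eq_coe_finsetCard, ← hf.encard_image]
  refine Set.encard_le_encard ?_
  rintro _ ⟨z, hz, rfl⟩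
  refine ⟨fun j => ?_, ?_⟩
  · have := Finset.mem_Icc.1 (Fintype.mem_piFinset.1 hz j)
    exact ⟨by simpa [f] using (by exact_mod_cast this.1 : (-(r j : ℝ)) ≤ z j),
      by simpa [f] using (by exact_mod_cast this.2 : (z j : ℝ) ≤ r j)⟩
  · refine (Module.Basis.mem_span_iff_repr_mem ℤ _ _).2 fun j => ⟨z j, ?_⟩
    simp [f]

/-- Lower bounds on the packing minima suffice: each factor is then at most `2 r j + 1`, and the box
holds at least the product of these numbers. -/
theorem encard_box_inter_integerLattice {n : ℕ} {r : Fin n → ℕ} (hr : ∀ j, 0 < r j)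
    (hmono : Monotone r) :
    ((box (fun j => (r j : ℝ≥0)) : Set (EuclideanSpace ℝ (Fin n))) ∩
        (integerLattice n : Set (EuclideanSpace ℝ (Fin n)))).encard =
      ((∏ i ∈ Finset.Icc 1 n,
        ⌊1 / packingMinimum (box (fun j => (r j : ℝ≥0)) : Set (EuclideanSpace ℝ (Fin n)))
          (integerLattice n) i + 1⌋₊ : ℕ) : ℕ∞) := by
  refine le_antisymm (encard_inter_le_prod_packingMinimum (ConvexBody.convex _)
    (ConvexBody.isCompact _) (interior_box_nonempty _ fun j => by exact_mod_cast hr j))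
    (le_trans ?_ (prod_le_encard_box_inter_integerLattice r))
  rw [Nat.cast_le, ← Finset.Ico_add_one_right_eq_Icc, Finset.prod_Ico_eq_prod_range,
    Nat.add_sub_cancel, Finset.prod_range]
  refine Finset.prod_le_prod' fun j _ => ?_
  have hrj : (0 : ℝ) < r j := Nat.cast_pos.2 (hr j)
  have h := inv_le_packingMinimum_box hr hmono j
  rw [add_comm 1 (j : ℕ)]
  have hle : 1 / packingMinimum (box (fun j => (r j : ℝ≥0)) : Set (EuclideanSpace ℝ (Fin n)))
      (integerLattice n) (j + 1) ≤ 2 * r j := by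
    rw [one_div_le ((by positivity : (0 : ℝ) < 1 / (2 * r j)).trans_le h) (by positivity)]
    exact h
  refine Nat.floor_le_of_le ?_
  push_cast
  linarith

theorem theorem1p3 (n : ℕ) :
    (∀ (K : ConvexBody (EuclideanSpace ℝ (Fin n)))
        (Λ : Submodule ℤ (EuclideanSpace ℝ (Fin n))) [DiscreteTopology Λ] [IsZLattice ℝ Λ],
      (interior (K : Set (EuclideanSpace ℝ (Fin n)))).Nonempty →
        (∀ i ∈ Finset.Icc 1 n, 0 < packingMinimum (K : Set (EuclideanSpace ℝ (Fin n))) Λ i) ∧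
        ((K : Set (EuclideanSpace ℝ (Fin n))) ∩ (Λ : Set (EuclideanSpace ℝ (Fin n)))).encard ≤
          ((∏ i ∈ Finset.Icc 1 n,
            ⌊1 / packingMinimum (K : Set (EuclideanSpace ℝ (Fin n))) Λ i + 1⌋₊ : ℕ) : ℕ∞)) ∧
    (∀ r : Fin n → ℕ, (∀ j, 0 < r j) → Monotone r →
      ((box (fun j => (r j : ℝ≥0)) : Set (EuclideanSpace ℝ (Fin n))) ∩
          (integerLattice n : Set (EuclideanSpace ℝ (Fin n)))).encard =
        ((∏ i ∈ Finset.Icc 1 n,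
          ⌊1 / packingMinimum (box (fun j => (r j : ℝ≥0)) : Set (EuclideanSpace ℝ (Fin n)))
            (integerLattice n) i + 1⌋₊ : ℕ) : ℕ∞)) := by
  refine ⟨fun K Λ _ _ hK => ⟨fun i hi => packingMinimum_pos K.isCompact hK hi,
    encard_inter_le_prod_packingMinimum K.convex K.isCompact hK⟩,
    fun r hr hmono => encard_box_inter_integerLattice hr hmono⟩
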